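/- Let $\mathcal M$ be a von Neumann algebra with a faithful normal tracial state $\tau$. Write $\|x\|$ for the operator norm of $x\in\mathcal M$, let $L^2(\mathcal M,\tau)$ be the Hilbert space completion of $\mathcal M$ for the inner product $\langle x,y\rangle_\tau=\tau(y^*x)$, with norm $\|\cdot\|_\tau$, and let $\widehat x\in L^2(\mathcal M,\tau)$ be the vector given by $x\in\mathcal M$, so that $\|\widehat x\|_\tau=\tau(x^*x)^{1/2}$. For a subalgebra $P$ of $\mathcal M$ put $B_1(P)=\{x\in P:\|x\|\le 1\}$ and $\widehat{B_1(P)}=\{\widehat x: x\in B_1(P)\}$. For subalgebras $P,Q$ of $\mathcal M$ and $\gamma>0$ write $P\subset_\gamma Q$ if for every $x\in B_1(P)$ there is $y\in Q$ with $\|\widehat x-\widehat y\|_\tau\le\gamma$. Christensen's distance is $$d_C(P,Q)=\inf\{\gamma>0 : P\subset_\gamma Q \text{ and } Q\subset_\gamma P\},$$ and the Mashood–Taylor distance $d_{MT}(P,Q)$ is the Hausdorff distance, with respect to $\|\cdot\|_\tau$, between $\widehat{B_1(P)}$ and $\widehat{B_1(Q)}$. Then $$d_C(P,Q)=d_{MT}(P,Q)$$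 for all $*$-subalgebras $P,Q$ of $\mathcal M$ that contain $1_{\mathcal M}$ (no closedness is assumed). -/

import Mathlib

open scoped ComplexOrder

noncomputable section

namespace VonNeumannAlgebra

variable {H : Type*} [NormedAddCommGroup H] [InnerProductSpace ℂ H] [CompleteSpace H]

/-- A von Neumann algebra is norm closed; with this instance Mathlib makes it a C⋆-algebra. -/
instance instIsClosedToStarSubalgebra (M : VonNeumannAlgebra H) :
    IsClosed (M.toStarSubalgebra : Set (H →L[ℂ] H)) := by
  rw [coe_toStarSubalgebra, ← centralizer_centralizer M]
  exact Set.isClosed_centralizer _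

/-- For the order inherited from the operators on `H`, the positive elements of a
von Neumann algebra `M` are the elements `star s * s` with `s` in `M`. -/
instance instStarOrderedRingToStarSubalgebra (M : VonNeumannAlgebra H) :
    StarOrderedRing M.toStarSubalgebra := by
  refine StarOrderedRing.of_nonneg_iff' (fun {x y} hxy z => ?_) (fun x => ⟨fun hx => ?_, ?_⟩)
  · have h : (x : H →L[ℂ] H) ≤ y := hxy
    exact (add_le_add_right h (z : H →L[ℂ] H) : _)
  · have h : (0 : H →L[ℂ] H) ≤ x := hx
    have hsa : IsSelfAdjoint x := Subtype.ext (IsSelfAdjoint.of_nonneg h).star_eq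
    have hspec : SpectrumRestricts x ContinuousMap.realToNNReal := by
      have h2 : SpectrumRestricts (x : H →L[ℂ] H) ContinuousMap.realToNNReal :=
        SpectrumRestricts.nnreal_of_nonneg h
      rw [SpectrumRestricts.nnreal_iff] at h2 ⊢
      intro r hr
      refine h2 r ?_
      rw [← spectrum.preimage_algebraMap ℂ, ← StarSubalgebra.spectrum_eq]
      simpa using (spectrum.algebraMap_mem_iff ℂ).2 hr
    obtain ⟨s, hs, -, hss⟩ := CFC.exists_sqrt_of_isSelfAdjoint_of_quasispectrumRestricts hsa
      ((quasispectrumRestricts_iff_spectrumRestricts (a := x)).2 hspec)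
    exact ⟨s, by rw [hs.star_eq, ← hss]⟩
  · rintro ⟨s, rfl⟩
    exact (star_mul_self_nonneg (s : H →L[ℂ] H) : _)

/-- A positive linear functional `τ` on `M` is a faithful normal tracial state. -/
structure IsFaithfulNormalTracialState {M : VonNeumannAlgebra H}
    (τ : M.toStarSubalgebra →ₚ[ℂ] ℂ) : Prop where
  map_one : τ 1 = 1
  faithful : ∀ x : M.toStarSubalgebra, τ (star x * x) = 0 → x = 0
  tracial : ∀ x y : M.toStarSubalgebra, τ (x * y) = τ (y * x)
  /-- `τ` preserves suprema of (bounded) upward directed families of positive elements. -/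
  normal : ∀ (s : Set M.toStarSubalgebra) (a : M.toStarSubalgebra), s.Nonempty →
    DirectedOn (· ≤ ·) s → (∀ x ∈ s, 0 ≤ x) → IsLUB s a → IsLUB (τ '' s) (τ a)

/-- The canonical map `x ↦ x̂` from `M` to the Hilbert space `L²(M, τ)`, the completion of `M` for
the inner product `τ (star y * x)`, that is, the GNS space of `τ`. -/
def hat {M : VonNeumannAlgebra H} (τ : M.toStarSubalgebra →ₚ[ℂ] ℂ) (x : M.toStarSubalgebra) :
    τ.GNS :=
  (τ.toPreGNS x : τ.GNS)

/-- The norm of `x̂` is `τ (star x * x) ^ (1 / 2)`. -/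
theorem norm_hat {M : VonNeumannAlgebra H} (τ : M.toStarSubalgebra →ₚ[ℂ] ℂ)
    (x : M.toStarSubalgebra) : ‖hat τ x‖ = √(τ (star x * x)).re :=
  UniformSpace.Completion.norm_coe _

/-- The closed unit ball of a subalgebra `P` of `M`, for the operator norm. -/
def unitBall {M : VonNeumannAlgebra H} (P : StarSubalgebra ℂ M.toStarSubalgebra) :
    Set M.toStarSubalgebra :=
  {x | x ∈ P ∧ ‖x‖ ≤ 1}

/-- The near inclusion of `P` in `Q` up to `γ`: each `x` in the closed unit ball of `P` (for the
operator norm) is within `γ`, in the norm of `L²(M, τ)`, of some `y` in `Q`. -/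
def NearIncluded {M : VonNeumannAlgebra H} (τ : M.toStarSubalgebra →ₚ[ℂ] ℂ) (γ : ℝ)
    (P Q : StarSubalgebra ℂ M.toStarSubalgebra) : Prop :=
  ∀ x ∈ unitBall P, ∃ y ∈ Q, ‖hat τ x - hat τ y‖ ≤ γ

/-- Christensen's distance. -/
def christensenDist {M : VonNeumannAlgebra H} (τ : M.toStarSubalgebra →ₚ[ℂ] ℂ)
    (P Q : StarSubalgebra ℂ M.toStarSubalgebra) : ℝ :=
  sInf {γ : ℝ | 0 < γ ∧ NearIncluded τ γ P Q ∧ NearIncluded τ γ Q P}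

/-- The Mashood–Taylor distance: the Hausdorff distance in `L²(M, τ)` of the operator norm closed
unit balls. -/
def mashoodTaylorDist {M : VonNeumannAlgebra H} (τ : M.toStarSubalgebra →ₚ[ℂ] ℂ)
    (P Q : StarSubalgebra ℂ M.toStarSubalgebra) : ℝ :=
  Metric.hausdorffDist (hat τ '' unitBall P) (hat τ '' unitBall Q)

end VonNeumannAlgebra

end

/-! A point of the unit ball of `Q` is a point of `Q`, which gives one inequality. For the other,
take `x` in the unit ball of `P` and `y ∈ Q` near it, and cut the modulus of `y` down to at most 1,
giving `w`. Then `y - w = w * c²` with `c² = (|y| - 1)₊`, and `w⋆w` acts as the identity on `c²`. By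
traciality, `Re ⟪y - w, x - w⟫ = Re τ (c * (w⋆x) * c) - τ (c²) ≤ 0`, because `‖w⋆x‖ ≤ 1`. The angle
at `w` is thus not acute, and `w` is at least as close to `x` as `y` is. Since `w` is only in the
norm closure of `Q`, a small error `ε` brings it back into the unit ball of `Q`. -/

namespace CStarAlgebra

variable {A : Type*} [CStarAlgebra A]

/-- The truncation `w` of `y` to the closed unit ball: it is `y f(y⋆y)` with
`f(t) = 1 / max(1, √t)`, and `c ^ 2` is the positive part of `|y| - 1`. -/
theorem exists_truncation [PartialOrder A] [StarOrderedRing A] (Q : StarSubalgebra ℂ A) {y : A}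
    (hy : y ∈ Q) :
    ∃ w ∈ Q.topologicalClosure, ∃ c : A, ‖w‖ ≤ 1 ∧ IsSelfAdjoint c ∧
      y - w = w * (c * c) ∧ star w * w * (c * c) = c * c := by
  set f : ℝ → ℝ := fun t => (max 1 √t)⁻¹ with hf
  set g : ℝ → ℝ := fun t => √(max 0 (√t - 1)) with hg
  have hfc : Continuous f :=
    (continuous_const.max Real.continuous_sqrt).inv₀ fun t => by positivity
  have hgc : Continuous g := by fun_prop
  have hT : IsSelfAdjoint (star y * y) := .star_mul_self y
  have hspec : ∀ t ∈ spectrum ℝ (star y * y), 0 ≤ t := fun t ht =>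
    spectrum_nonneg_of_nonneg (star_mul_self_nonneg y) ht
  have hgg : cfc g (star y * y) * cfc g (star y * y) =
      cfc (fun t => g t * g t) (star y * y) :=
    (cfc_mul g g _ hgc.continuousOn hgc.continuousOn).symm
  have hsa : IsSelfAdjoint (cfc f (star y * y)) := cfc_predicate f _
  have hww : star (y * cfc f (star y * y)) * (y * cfc f (star y * y)) =
      cfc (fun t => f t * t * f t) (star y * y) := by
    rw [cfc_mul (fun t => f t * t) f _ (by fun_prop) (by fun_prop),
      cfc_mul f (fun t => t) _ (by fun_prop) (by fun_prop), cfc_id' ℝ (star y * y) hT,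
      star_mul, hsa.star_eq]
    simp only [mul_assoc]
  have hf0 : ∀ t, 0 < f t := fun t => by simp only [hf]; positivity
  have hfm : ∀ t, f t * max 1 √t = 1 := fun t => inv_mul_cancel₀ (by positivity)
  have hggt : ∀ t, g t * g t = max 0 (√t - 1) := fun t => Real.mul_self_sqrt (le_max_left _ _)
  refine ⟨y * cfc f (star y * y), mul_mem (Q.le_topologicalClosure hy) ?_,
    cfc g (star y * y), ?_, cfc_predicate g _, ?_, ?_⟩
  · have hmem : star y * y ∈ Q.topologicalClosure :=
      Q.le_topologicalClosure (mul_mem (star_mem hy) hy)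
    exact cfc_mem (𝕜 := ℝ) (𝕜' := ℂ) (hs := Q.isClosed_topologicalClosure) f hmem
  · have h : ‖star (y * cfc f (star y * y)) * (y * cfc f (star y * y))‖ ≤ 1 := by
      rw [hww]
      refine norm_cfc_le zero_le_one fun t ht => ?_
      have ht0 := hspec t ht
      have h1 : f t * √t ≤ 1 := by
        rw [← hfm t]
        exact mul_le_mul_of_nonneg_left (le_max_right _ _) (hf0 t).le
      have h2 : 0 ≤ f t * √t := mul_nonneg (hf0 t).le (Real.sqrt_nonneg t)
      have h3 : f t * t * f t = (f t * √t) * (f t * √t) := by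
        nth_rw 2 [← Real.mul_self_sqrt ht0]
        ring
      rw [h3, Real.norm_of_nonneg (mul_nonneg h2 h2)]
      exact mul_le_one₀ h1 h2 h1
    rw [CStarRing.norm_star_mul_self] at h
    exact le_of_not_gt fun h' => h.not_gt (one_lt_mul_of_lt_of_le h' h'.le)
  -- Since `1 + g t * g t = max 1 √t`, the identity `y = w + w * c²` comes from `f t * max 1 √t =
  -- 1`.
  · rw [sub_eq_iff_eq_add', mul_assoc, hgg, ← cfc_mul f _ _ (by fun_prop) (by fun_prop), ← mul_add,
      ← cfc_add _ f _ (by fun_prop) (by fun_prop),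
      cfc_congr (g := fun _ => 1), cfc_const_one ℝ (star y * y) hT, mul_one]
    intro t _
    change f t + f t * (g t * g t) = 1
    rw [hggt, ← mul_one_add, ← max_add_add_left, add_zero, add_sub_cancel]
    exact hfm t
  · rw [hww, hgg, ← cfc_mul _ _ _ (by fun_prop) (by fun_prop)]
    refine cfc_congr fun t ht => ?_
    change f t * t * f t * (g t * g t) = g t * g t
    rw [hggt]
    -- Either `g t = 0`, or `f t * √t = 1`.
    rcases le_total (√t) 1 with h | h
    · rw [max_eq_left (by linarith)]; ring
    · have h1 : f t * √t = 1 := by rw [← hfm t, max_eq_right h]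
      have h3 : f t * t * f t = (f t * √t) * (f t * √t) := by
        nth_rw 2 [← Real.mul_self_sqrt (hspec t ht)]
        ring
      rw [h3, h1]; ring

/-- An element of the closed unit ball of the norm closure of a subalgebra is approximated by the
closed unit ball of the subalgebra. -/
theorem exists_mem_norm_le_one_norm_sub_lt (Q : StarSubalgebra ℂ A) {w : A}
    (hw : w ∈ Q.topologicalClosure) (hw1 : ‖w‖ ≤ 1) {ε : ℝ} (hε : 0 < ε) :
    ∃ q ∈ Q, ‖q‖ ≤ 1 ∧ ‖w - q‖ < ε := by
  have hw' : w ∈ closure (Q : Set A) := by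
    rwa [← StarSubalgebra.topologicalClosure_coe]
  obtain ⟨q, hq, hqw⟩ := Metric.mem_closure_iff.1 hw' (ε / 2) (half_pos hε)
  rw [dist_eq_norm] at hqw
  have hqn : ‖q‖ ≤ 1 + ε / 2 := by
    have := norm_sub_le w (w - q)
    rw [sub_sub_cancel] at this
    linarith
  have hpos : 0 < 1 + ε / 2 := by positivity
  -- Scaling by `r` brings `q` into the unit ball and moves it by at most `(1 - r) * (1 + ε / 2) = ε
  -- / 2`.
  set r : ℝ := (1 + ε / 2)⁻¹ with hr
  have hr0 : 0 < r := inv_pos.2 hpos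
  have hr1 : (1 - r) * (1 + ε / 2) = ε / 2 := by
    rw [sub_mul, inv_mul_cancel₀ hpos.ne']; ring
  have hr2 : 0 ≤ 1 - r := by
    by_contra! h
    have := mul_neg_of_neg_of_pos h hpos
    linarith
  refine ⟨(r : ℂ) • q, Q.smul_mem hq _, ?_, ?_⟩
  · rw [norm_smul, Complex.norm_real, Real.norm_of_nonneg hr0.le]
    calc r * ‖q‖ ≤ r * (1 + ε / 2) := by gcongr
      _ = 1 := inv_mul_cancel₀ hpos.ne'
  · have h1 : w - (r : ℂ) • q = (w - q) + ((1 - r : ℝ) : ℂ) • q := by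
      push_cast
      module
    have h2 : ‖((1 - r : ℝ) : ℂ) • q‖ ≤ ε / 2 := by
      rw [norm_smul, Complex.norm_real, Real.norm_of_nonneg hr2, ← hr1]
      gcongr
    rw [h1]
    linarith [norm_add_le (w - q) (((1 - r : ℝ) : ℂ) • q)]

end CStarAlgebra

namespace PositiveLinearMap

variable {A : Type*} [CStarAlgebra A] [PartialOrder A] [StarOrderedRing A] (τ : A →ₚ[ℂ] ℂ)

theorem norm_toPreGNS_mul_le (a b : A) : ‖τ.toPreGNS (a * b)‖ ≤ ‖a‖ * ‖τ.toPreGNS b‖ :=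
  (τ.leftMulMapPreGNS a).le_of_opNorm_le
    (LinearMap.mkContinuous_norm_le _ (norm_nonneg a) _) (τ.toPreGNS b)

theorem norm_toPreGNS_le (h1 : τ 1 = 1) (a : A) : ‖τ.toPreGNS a‖ ≤ ‖a‖ := by
  have h : ‖τ.toPreGNS 1‖ = 1 := by simp [preGNS_norm_def, h1]
  simpa [h] using τ.norm_toPreGNS_mul_le a 1

/-- Cauchy–Schwarz for the vectors of `c` and `z * c`; it spares any self-adjointness of `z`. -/
theorem re_apply_conjugate_le {c z : A} (hc : IsSelfAdjoint c) (hz : ‖z‖ ≤ 1) :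
    (τ (c * (z * c))).re ≤ (τ (c * c)).re := by
  have h1 : (τ (c * c)).re = ‖τ.toPreGNS c‖ ^ 2 := by
    have h := congrArg Complex.re (τ.preGNS_norm_sq (τ.toPreGNS c))
    rw [ofPreGNS_toPreGNS, hc.star_eq] at h
    rw [← h]
    norm_cast
  have h2 : τ (c * (z * c)) = inner ℂ (τ.toPreGNS c) (τ.toPreGNS (z * c)) := by
    rw [preGNS_inner_def, ofPreGNS_toPreGNS, ofPreGNS_toPreGNS, hc.star_eq]
  rw [h1, h2]
  calc (inner ℂ (τ.toPreGNS c) (τ.toPreGNS (z * c))).re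
      ≤ ‖τ.toPreGNS c‖ * ‖τ.toPreGNS (z * c)‖ := re_inner_le_norm (𝕜 := ℂ) _ _
    _ ≤ ‖τ.toPreGNS c‖ * (1 * ‖τ.toPreGNS c‖) := by
      gcongr
      exact (τ.norm_toPreGNS_mul_le z c).trans (by gcongr)
    _ = ‖τ.toPreGNS c‖ ^ 2 := by ring

/-- Truncation to the closed unit ball does not increase the tracial `L²` distance to a point of
that ball. -/
theorem norm_toPreGNS_sub_le_of_truncation (hτ : ∀ x y, τ (x * y) = τ (y * x)) {x y w c : A}
    (hx : ‖x‖ ≤ 1) (hw : ‖w‖ ≤ 1) (hc : IsSelfAdjoint c) (hyw : y - w = w * (c * c))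
    (hwc : star w * w * (c * c) = c * c) :
    ‖τ.toPreGNS (x - w)‖ ≤ ‖τ.toPreGNS (x - y)‖ := by
  have hwc' : c * c * (star w * w) = c * c := by
    simpa [hc.star_eq, mul_assoc] using congrArg star hwc
  have hz : ‖star w * x‖ ≤ 1 :=
    (norm_mul_le _ _).trans (by rw [norm_star]; exact mul_le_one₀ hw (norm_nonneg _) hx)
  have hinner : (inner ℂ (τ.toPreGNS (y - w)) (τ.toPreGNS (x - w))).re ≤ 0 := by
    rw [preGNS_inner_def, ofPreGNS_toPreGNS, ofPreGNS_toPreGNS, hyw]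
    have h : star (w * (c * c)) * (x - w) = c * (c * (star w * x)) - c * c := by
      rw [mul_sub, star_mul, star_mul, hc.star_eq, mul_assoc _ (star w) w, hwc']
      simp only [mul_assoc]
    -- Traciality moves one `c` to the right of `star w * x`.
    rw [h, map_sub, hτ c, mul_assoc, Complex.sub_re, sub_nonpos]
    exact τ.re_apply_conjugate_le hc hz
  have hsub : τ.toPreGNS (x - y) = τ.toPreGNS (x - w) - τ.toPreGNS (y - w) := by
    rw [← map_sub, sub_sub_sub_cancel_right]
  refine le_of_sq_le_sq ?_ (norm_nonneg _)
  rw [hsub, norm_sub_sq (𝕜 := ℂ), ← inner_re_symm]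
  have h : RCLike.re (inner ℂ (τ.toPreGNS (y - w)) (τ.toPreGNS (x - w))) ≤ 0 := hinner
  nlinarith [sq_nonneg ‖τ.toPreGNS (y - w)‖]

end PositiveLinearMap

namespace VonNeumannAlgebra

variable {H : Type*} [NormedAddCommGroup H] [InnerProductSpace ℂ H] [CompleteSpace H]
  {M : VonNeumannAlgebra H} {τ : M.toStarSubalgebra →ₚ[ℂ] ℂ}
  {P Q : StarSubalgebra ℂ M.toStarSubalgebra}

theorem norm_hat_sub_hat (x y : M.toStarSubalgebra) :
    ‖hat τ x - hat τ y‖ = ‖τ.toPreGNS (x - y)‖ := by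
  rw [hat, hat, ← UniformSpace.Completion.coe_sub, UniformSpace.Completion.norm_coe, map_sub]

theorem norm_hat_le (h1 : τ 1 = 1) (x : M.toStarSubalgebra) : ‖hat τ x‖ ≤ ‖x‖ := by
  rw [hat, UniformSpace.Completion.norm_coe]
  exact τ.norm_toPreGNS_le h1 x

theorem zero_mem_unitBall : (0 : M.toStarSubalgebra) ∈ unitBall P :=
  ⟨zero_mem P, by simp⟩

theorem nearIncluded_one (h1 : τ 1 = 1) : NearIncluded τ 1 P Q := fun x hx =>
  ⟨0, zero_mem Q, by
    rw [norm_hat_sub_hat, sub_zero]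
    exact (τ.norm_toPreGNS_le h1 x).trans hx.2⟩

theorem isBounded_hat_unitBall (h1 : τ 1 = 1) :
    Bornology.IsBounded (hat τ '' unitBall P) := by
  refine isBounded_iff_forall_norm_le.2 ⟨1, ?_⟩
  rintro _ ⟨x, hx, rfl⟩
  exact (norm_hat_le h1 x).trans hx.2

/-- A near inclusion sends the unit ball near the unit ball, up to an arbitrarily small error. -/
theorem NearIncluded.exists_mem_unitBall {γ : ℝ} (h : NearIncluded τ γ P Q)
    (hτ : IsFaithfulNormalTracialState τ) {ε : ℝ} (hε : 0 < ε) {x : M.toStarSubalgebra}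
    (hx : x ∈ unitBall P) : ∃ q ∈ unitBall Q, ‖hat τ x - hat τ q‖ ≤ γ + ε := by
  obtain ⟨y, hy, hxy⟩ := h x hx
  obtain ⟨w, hwQ, c, hw, hc, hyw, hwc⟩ := CStarAlgebra.exists_truncation Q hy
  obtain ⟨q, hq, hq1, hqw⟩ := CStarAlgebra.exists_mem_norm_le_one_norm_sub_lt Q hwQ hw hε
  refine ⟨q, ⟨hq, hq1⟩, ?_⟩
  have h1 : ‖hat τ x - hat τ w‖ ≤ γ := by
    rw [norm_hat_sub_hat] at hxy ⊢
    exact (τ.norm_toPreGNS_sub_le_of_truncation hτ.tracial hx.2 hw hc hyw hwc).trans hxy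
  have h2 : ‖hat τ w - hat τ q‖ ≤ ε := by
    rw [norm_hat_sub_hat]
    exact (τ.norm_toPreGNS_le hτ.map_one _).trans hqw.le
  exact (norm_sub_le_norm_sub_add_norm_sub _ (hat τ w) _).trans (add_le_add h1 h2)

theorem christensenDist_eq_mashoodTaylorDist (hτ : IsFaithfulNormalTracialState τ) :
    christensenDist τ P Q = mashoodTaylorDist τ P Q := by
  refine le_antisymm ?_ ?_
  · refine le_of_forall_gt_imp_ge_of_dense fun r hr => ?_
    -- An infinite distance would be read as the default value 0 by `hausdorffDist`.
    have hfin := Metric.hausdorffEDist_ne_top_of_nonempty_of_bounded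
      (Set.Nonempty.image (hat τ) ⟨0, zero_mem_unitBall (P := P)⟩)
      (Set.Nonempty.image (hat τ) ⟨0, zero_mem_unitBall (P := Q)⟩)
      (isBounded_hat_unitBall hτ.map_one) (isBounded_hat_unitBall hτ.map_one)
    refine csInf_le ⟨0, fun γ hγ => hγ.1.le⟩
      ⟨Metric.hausdorffDist_nonneg.trans_lt hr, fun x hx => ?_, fun x hx => ?_⟩
    · obtain ⟨_, ⟨y, hy, rfl⟩, hxy⟩ :=
        Metric.exists_dist_lt_of_hausdorffDist_lt (Set.mem_image_of_mem (hat τ) hx) hr hfin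
      exact ⟨y, hy.1, by rw [← dist_eq_norm]; exact hxy.le⟩
    · obtain ⟨_, ⟨y, hy, rfl⟩, hxy⟩ :=
        Metric.exists_dist_lt_of_hausdorffDist_lt' (Set.mem_image_of_mem (hat τ) hx) hr hfin
      exact ⟨y, hy.1, by rw [← dist_eq_norm, dist_comm]; exact hxy.le⟩
  -- `γ = 1` is admissible, with approximant 0, so the infimum is over a nonempty set.
  · refine le_csInf
      ⟨1, one_pos, nearIncluded_one hτ.map_one, nearIncluded_one hτ.map_one⟩ ?_
    rintro γ ⟨hγ, hPQ, hQP⟩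
    refine le_of_forall_pos_le_add fun ε hε => ?_
    refine Metric.hausdorffDist_le_of_mem_dist (by positivity) ?_ ?_
    · rintro _ ⟨x, hx, rfl⟩
      obtain ⟨q, hq, h⟩ := hPQ.exists_mem_unitBall hτ hε hx
      exact ⟨_, Set.mem_image_of_mem _ hq, by rwa [dist_eq_norm]⟩
    · rintro _ ⟨x, hx, rfl⟩
      obtain ⟨q, hq, h⟩ := hQP.exists_mem_unitBall hτ hε hx
      exact ⟨_, Set.mem_image_of_mem _ hq, by rwa [dist_eq_norm]⟩

end VonNeumannAlgebra

/-- On the unital `*`-subalgebras (not assumed closed) of a von Neumann algebra with a faithful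
normal tracial state, Christensen's distance is the Mashood–Taylor distance. -/
theorem proposition5p8 {H : Type*} [NormedAddCommGroup H] [InnerProductSpace ℂ H] [CompleteSpace H]
    (M : VonNeumannAlgebra H) (τ : M.toStarSubalgebra →ₚ[ℂ] ℂ)
    (hτ : VonNeumannAlgebra.IsFaithfulNormalTracialState τ)
    (P Q : StarSubalgebra ℂ M.toStarSubalgebra) :
    VonNeumannAlgebra.christensenDist τ P Q = VonNeumannAlgebra.mashoodTaylorDist τ P Q :=
  VonNeumannAlgebra.christensenDist_eq_mashoodTaylorDist hτ
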